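/- A formal vector field $Y=b\,\partial_x+b_1\,\partial_{y_1}+b_2\,\partial_{y_2}$ on $(\mathbb C^3,0)$ has coefficients $b,b_1,b_2\in\mathbb C[[x,y_1,y_2]]$. Let $\mathfrak m$ be the ideal of formal series without constant term. A fibered formal diffeomorphism is a triple $\Phi=(x,\phi_1,\phi_2)$ with $\phi_1,\phi_2\in\mathfrak m$ and invertible Jacobian matrix at $0$; it acts by $\Phi_*Y=(\mathrm D\Phi\cdot Y)\circ\Phi^{-1}$. A doubly-resonant saddle-node with eigenvalues $0,-\lambda,\lambda$, where $\lambda\in\mathbb C\setminus\{0\}$, is a formal vector field $Y$ vanishing at the origin for which some fibered formal diffeomorphism conjugates $Y$ to a field of the form $$x^2\partial_x+\bigl(-\lambda y_1+F_1(x,y_1,y_2)\bigr)\partial_{y_1}+\bigl(\lambda y_2+F_2(x,y_1,y_2)\bigr)\partial_{y_2},\qquad F_1,F_2\in\mathfrak m^2. \quad (*)$$ Let $A(x)$ be the $2\times2$ matrix over $\mathbb C[[x]]$ of the part of $(*)$ that is linear in $(y_1,y_2)$. The residue of $Y$ is $\operatorname{res}(Y)=\bigl(\operatorname{Tr}A(x)/x\bigr)_{|x=0}$,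 computed on a field of the form $(*)$ (with any nonzero eigenvalue parameter) to which $Y$ is conjugate by a fibered formal diffeomorphism; the value does not depend on the choice of that field. **Theorem 1.** Let $Y$ be a doubly-resonant saddle-node with eigenvalues $0,-\lambda,\lambda$ such that $\operatorname{res}(Y)\notin\mathbb Q_{\le0}$. Then there exist a fibered formal diffeomorphism $\Phi$, numbers $a_1,a_2\in\mathbb C$ with $a_1+a_2=\operatorname{res}(Y)$, and series $c_1,c_2\in v\,\mathbb C[[v]]$ such that, with $v=y_1y_2$, $$\Phi_*Y=x^2\partial_x+\bigl(-\lambda+a_1x+c_1(v)\bigr)y_1\partial_{y_1}+\bigl(\lambda+a_2x+c_2(v)\bigr)y_2\partial_{y_2}.$$ -/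

import Mathlib

/-- Formal power series over `ℂ` in `(x, y₁, y₂)`; the variables have indices `0, 1, 2`. -/
abbrev FSeries : Type := MvPowerSeries (Fin 3) ℂ

/-- The ideal of formal power series with zero constant term. -/
noncomputable def maxIdeal : Ideal FSeries :=
  RingHom.ker (MvPowerSeries.constantCoeff (σ := Fin 3) (R := ℂ))

/-- The formal vector field `b ∂_x + b₁ ∂_{y₁} + b₂ ∂_{y₂}`, as the triple `(b, b₁, b₂)`. -/
abbrev FVectorField : Type := Fin 3 → FSeries

/-- Singular formal vector fields: those that vanish at the origin. -/
def IsSingularField (Y : FVectorField) : Prop :=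
  ∀ i, Y i ∈ maxIdeal

/-- The Lie derivative `L_Y f = b ∂f/∂x + b₁ ∂f/∂y₁ + b₂ ∂f/∂y₂`. -/
noncomputable def lieDeriv (Y : FVectorField) (f : FSeries) : FSeries :=
  ∑ j, Y j * MvPowerSeries.pderiv ℂ j f

/-- The Jacobian matrix at the origin of a triple of formal power series. -/
noncomputable def jacobianAtZero (Φ : Fin 3 → FSeries) : Matrix (Fin 3) (Fin 3) ℂ :=
  Matrix.of fun i j => MvPowerSeries.constantCoeff (MvPowerSeries.pderiv ℂ j (Φ i))

/-- Formal diffeomorphisms of `ℂ³` fixing the origin: `Φ(0) = 0` and `D₀Φ` is invertible. -/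
def IsFormalDiffeo (Φ : Fin 3 → FSeries) : Prop :=
  (∀ i, MvPowerSeries.constantCoeff (Φ i) = 0) ∧ IsUnit (jacobianAtZero Φ)

/-- Formal diffeomorphisms fibered in `x`: `Φ(x, y) = (x, φ(x, y))`. -/
def IsFiberedDiffeo (Φ : Fin 3 → FSeries) : Prop :=
  IsFormalDiffeo Φ ∧ Φ 0 = MvPowerSeries.X 0

/-- For a formal diffeomorphism `Φ`, the identity `Φ_* Y = Z`, where
`Φ_* Y = (DΦ · Y) ∘ Φ⁻¹`, written without the inverse: `DΦ · Y = Z ∘ Φ`. The `i`-th coordinate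
of `DΦ · Y` is the Lie derivative of the `i`-th component of `Φ` along `Y`. -/
def PushesForwardTo (Φ : Fin 3 → FSeries) (Y Z : FVectorField) : Prop :=
  ∀ i, lieDeriv Y (Φ i) = MvPowerSeries.subst Φ (Z i)

/-- The vector fields
`x² ∂_x + (-l y₁ + F₁(x, y)) ∂_{y₁} + (l y₂ + F₂(x, y)) ∂_{y₂}`
with `l ≠ 0` and `F₁`, `F₂` in the square of the maximal ideal. -/
def IsPreparedSaddleNode (l : ℂ) (Y : FVectorField) : Prop :=
  l ≠ 0 ∧ ∃ F₁ F₂ : FSeries, F₁ ∈ maxIdeal ^ 2 ∧ F₂ ∈ maxIdeal ^ 2 ∧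
    Y = ![MvPowerSeries.X 0 ^ 2,
      -(l • MvPowerSeries.X 1) + F₁,
      l • MvPowerSeries.X 2 + F₂]

/-- Doubly-resonant saddle-nodes with eigenvalues `0, -l, l`: the singular formal vector fields
that are conjugate, under a fibered formal diffeomorphism, to a prepared one. -/
def IsDoublyResonantSaddleNode (l : ℂ) (Y : FVectorField) : Prop :=
  IsSingularField Y ∧ ∃ (Φ : Fin 3 → FSeries) (Z : FVectorField),
    IsFiberedDiffeo Φ ∧ PushesForwardTo Φ Y Z ∧ IsPreparedSaddleNode l Z

/-- The matrix `A(x)` of the part of `Y` that is linear in `y`: its `(i, j)` entry is the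
coefficient of `y_j` in the `y_i`-component of `Y`, a power series in `x`. -/
noncomputable def linearPart (Y : FVectorField) : Matrix (Fin 2) (Fin 2) (PowerSeries ℂ) :=
  Matrix.of fun i j => PowerSeries.mk fun n =>
    MvPowerSeries.coeff (Finsupp.single 0 n + Finsupp.single j.succ 1) (Y i.succ)

/-- The number `(Tr A(x) / x)|_{x = 0}` for a prepared field, for which `Tr A(0) = 0`. -/
noncomputable def preparedResidue (Y : FVectorField) : ℂ :=
  PowerSeries.coeff 1 (linearPart Y).trace

/-- `r` is the residue of the doubly-resonant saddle-node `Y`: it is read off from a prepared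
field that is conjugate to `Y` under a fibered formal diffeomorphism (the identity, if `Y` itself
is prepared). -/
def HasResidue (Y : FVectorField) (r : ℂ) : Prop :=
  ∃ (l : ℂ) (Φ : Fin 3 → FSeries) (Z : FVectorField),
    IsFiberedDiffeo Φ ∧ PushesForwardTo Φ Y Z ∧ IsPreparedSaddleNode l Z ∧ r = preparedResidue Z

/-- The field `x² ∂_x + (-l + a₁ x + c₁(v)) y₁ ∂_{y₁} + (l + a₂ x + c₂(v)) y₂ ∂_{y₂}`
with `v = y₁ y₂`. -/
noncomputable def normalForm (l a₁ a₂ : ℂ) (c₁ c₂ : PowerSeries ℂ) : FVectorField :=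
  let x : FSeries := MvPowerSeries.X 0
  let y₁ : FSeries := MvPowerSeries.X 1
  let y₂ : FSeries := MvPowerSeries.X 2
  ![x ^ 2,
    (MvPowerSeries.C (-l) + a₁ • x + PowerSeries.subst (y₁ * y₂) c₁) * y₁,
    (MvPowerSeries.C l + a₂ • x + PowerSeries.subst (y₁ * y₂) c₂) * y₂]

/-! It is enough to normalize a prepared field `Z` conjugate to `Y`, with parameter `l` and higher
order terms `F`. One looks for `φ_j = y_j + ...` with `L_Z φ_j = (± l + a_j x + c_j(φ₁ φ₂)) φ_j`,
where `a_j` is the coefficient of `x y_j` in the `y_j`-component of `Z`; then `a₁ + a₂` is the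
residue.

Monomials are graded by degree and by charge. In the `j`-th equation a monomial is resonant if it
has the charge of `y_j`, that is, if it is `x^k v^q y_j` with `v = y₁ y₂`. At a nonresonant `m` the
equation determines the coefficient of `m` in `φ_j`, with factor `l` times the nonzero charge
difference. At `v^q y_j` it determines the coefficient of `v^q` in `c_j`, with factor `-1`. At
`x^(k+1) v^q y_j` it determines the coefficient of `x^k v^q y_j` in `φ_j`, one degree lower, with
factor `k + q (a₁ + a₂)`. This vanishes only for `k = q = 0`, where the choice of `a_j` already
solves the equation, or when the residue is `-k/q` (`diagonalCoeff_ne_zero`).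

The resonant quadratic terms of `F` are exactly the `a_j x y_j`, and the other quadratic terms
change the charge. This makes the system triangular (`coeff_defect_triangular`), hence solvable
(`exists_solution_of_triangular`). Composing its solution with the conjugacy from `Y` to `Z` gives
the theorem, up to an exchange of `y₁` and `y₂` if `Z` has the opposite eigenvalue parameter. -/

/-! ### Filtration of formal series by total degree. -/

open MvPowerSeries in
/-- All the coefficients of total degree less than `n` vanish. -/
def VanishesBelow (n : ℕ) (f : FSeries) : Prop :=
  ∀ d : Fin 3 →₀ ℕ, d.degree < n → coeff d f = 0

namespace VanishesBelow

open MvPowerSeries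

variable {n k : ℕ} {f g : FSeries}

theorem mono (hf : VanishesBelow n f) (h : k ≤ n) : VanishesBelow k f :=
  fun d hd => hf d (by omega)

theorem add (hf : VanishesBelow n f) (hg : VanishesBelow n g) : VanishesBelow n (f + g) :=
  fun d hd => by rw [map_add, hf d hd, hg d hd, add_zero]

theorem sub (hf : VanishesBelow n f) (hg : VanishesBelow n g) : VanishesBelow n (f - g) :=
  fun d hd => by rw [map_sub, hf d hd, hg d hd, sub_zero]

theorem mul (hf : VanishesBelow n f) (hg : VanishesBelow k g) : VanishesBelow (n + k) (f * g) := by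
  intro d hd
  rw [coeff_mul]
  refine Finset.sum_eq_zero fun p hp => ?_
  have hp' := congrArg Finsupp.degree (Finset.HasAntidiagonal.mem_antidiagonal.1 hp)
  rw [map_add] at hp'
  by_cases h : p.1.degree < n
  · rw [hf _ h, zero_mul]
  · rw [hg _ (by omega), mul_zero]

theorem mul_left (hf : VanishesBelow n f) (g : FSeries) : VanishesBelow n (g * f) := by
  have := mul (n := 0) (f := g) (fun d hd => absurd hd (by omega)) hf
  rwa [zero_add] at this

theorem smul (hf : VanishesBelow n f) (a : ℂ) : VanishesBelow n (a • f) :=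
  fun d hd => by simp [hf d hd]

theorem pow (hf : VanishesBelow n f) (k : ℕ) : VanishesBelow (k * n) (f ^ k) := by
  induction k with
  | zero => intro d hd; simp at hd
  | succ k ih => rw [pow_succ, Nat.succ_mul]; exact ih.mul hf

theorem sum {ι : Type*} {s : Finset ι} {F : ι → FSeries} (h : ∀ i ∈ s, VanishesBelow n (F i)) :
    VanishesBelow n (∑ i ∈ s, F i) :=
  fun d hd => by rw [map_sum]; exact Finset.sum_eq_zero fun i hi => h i hi d hd

theorem X (i : Fin 3) : VanishesBelow 1 (MvPowerSeries.X i : FSeries) := by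
  intro d hd
  have : d = 0 := (Finsupp.degree_eq_zero_iff d).1 (by omega)
  subst this
  simp

theorem pderiv (hf : VanishesBelow (n + 1) f) (i : Fin 3) :
    VanishesBelow n (MvPowerSeries.pderiv ℂ i f) := by
  intro d hd
  rw [coeff_pderiv, hf, zero_mul]
  rw [map_add, Finsupp.degree_single]
  omega

theorem one_iff : VanishesBelow 1 f ↔ constantCoeff f = 0 := by
  constructor
  · intro h
    rw [← coeff_zero_eq_constantCoeff_apply]
    exact h 0 (by simp)
  · intro h d hd
    have : d = 0 := (Finsupp.degree_eq_zero_iff d).1 (by omega)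
    rw [this, coeff_zero_eq_constantCoeff_apply, h]

theorem le_order (hf : VanishesBelow n f) : (n : ℕ∞) ≤ f.order := nat_le_order hf

theorem of_le_order (h : (n : ℕ∞) ≤ f.order) : VanishesBelow n f :=
  fun _ hd => coeff_of_lt_order (lt_of_lt_of_le (Nat.cast_lt.2 hd) h)

theorem subst {Φ : Fin 3 → FSeries} (hΦ : ∀ i, constantCoeff (Φ i) = 0)
    (hf : VanishesBelow n f) : VanishesBelow n (MvPowerSeries.subst Φ f) := by
  refine of_le_order (le_trans ?_
    (MvPowerSeries.le_order_subst (hasSubst_of_constantCoeff_zero hΦ) f))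
  have h1 : (1 : ℕ∞) ≤ ⨅ i, (Φ i).order :=
    le_iInf fun i => one_le_order_iff_constCoeff_eq_zero.2 (hΦ i)
  calc (n : ℕ∞) = 1 * n := (one_mul _).symm
    _ ≤ _ := mul_le_mul' h1 hf.le_order

theorem of_mem_maxIdeal_sq (h : f ∈ maxIdeal ^ 2) : VanishesBelow 2 f := by
  rw [pow_two] at h
  refine Submodule.mul_induction_on h (fun a ha b hb => ?_) (fun a b ha hb => ha.add hb)
  exact mul (one_iff.2 ((RingHom.mem_ker).1 ha)) (one_iff.2 ((RingHom.mem_ker).1 hb))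

end VanishesBelow

/-! ### Chain rule, and invariance of the linear part under conjugacy. -/

section Composition

open MvPowerSeries

theorem constantCoeff_subst_of_constantCoeff_zero {Φ : Fin 3 → FSeries}
    (hΦ : ∀ i, constantCoeff (Φ i) = 0) (f : FSeries) :
    constantCoeff (subst Φ f) = constantCoeff f := by
  have hs := hasSubst_of_constantCoeff_zero hΦ
  have h : constantCoeff (subst Φ (f - C (constantCoeff f))) = 0 :=
    constantCoeff_subst_eq_zero hs hΦ (by simp)
  rw [subst_sub hs, subst_C, map_sub, constantCoeff_C, sub_eq_zero] at h
  exact h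

theorem pderiv_aeval (Φ : Fin 3 → FSeries) (j : Fin 3) (p : MvPolynomial (Fin 3) ℂ) :
    pderiv ℂ j (MvPolynomial.aeval Φ p) =
      ∑ k, MvPolynomial.aeval Φ (MvPolynomial.pderiv k p) * pderiv ℂ j (Φ k) := by
  induction p using MvPolynomial.induction_on with
  | C a =>
    rw [MvPolynomial.aeval_C]
    simp [MvPowerSeries.algebraMap_apply]
  | add p q hp hq =>
    simp only [map_add, hp, hq, add_mul, Finset.sum_add_distrib]
  | mul_X p i hp =>
    simp only [map_mul, MvPolynomial.aeval_X, Derivation.leibniz, smul_eq_mul, hp, map_add,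
      MvPolynomial.pderiv_X, add_mul, Finset.sum_add_distrib, Finset.mul_sum]
    congr 1
    · rw [Finset.sum_eq_single i]
      · simp
      · intro k _ hk
        simp [hk.symm]
      · simp
    · exact Finset.sum_congr rfl fun k _ => by ring

/-- The chain rule for substitution of formal power series. -/
theorem pderiv_subst {Φ : Fin 3 → FSeries} (hΦ : ∀ i, constantCoeff (Φ i) = 0) (j : Fin 3)
    (f : FSeries) :
    pderiv ℂ j (subst Φ f) = ∑ k, subst Φ (pderiv ℂ k f) * pderiv ℂ j (Φ k) := by
  have hs := hasSubst_of_constantCoeff_zero hΦ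
  ext d
  -- Differentiation costs one degree, so a remainder of order `d.degree + 2` does not reach the
  -- coefficient at `d`; what is left is the polynomial case.
  set N := d.degree + 2 with hN
  obtain ⟨g, hg, hfg⟩ : ∃ g : FSeries, VanishesBelow N g ∧
      f = (truncTotal N f : MvPolynomial (Fin 3) ℂ) + g := by
    refine ⟨f - (truncTotal N f : MvPolynomial (Fin 3) ℂ), fun e he => ?_, by ring⟩
    rw [map_sub, MvPolynomial.coeff_coe, coeff_truncTotal _ he, sub_self]
  rw [hfg]
  simp only [subst_add hs, map_add, add_mul, Finset.sum_add_distrib, pderiv_coe, subst_coe,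
    pderiv_aeval]
  congr 1
  rw [(hg.subst hΦ).pderiv (n := d.degree + 1) j d (by omega), map_sum]
  refine (Finset.sum_eq_zero fun k _ => ?_).symm
  rw [mul_comm]
  exact (((hg.pderiv (n := d.degree + 1) k).subst hΦ).mul_left _) d (by omega)

theorem lieDeriv_subst {Φ : Fin 3 → FSeries} (hΦ : ∀ i, constantCoeff (Φ i) = 0)
    {Y Z : FVectorField} (h : PushesForwardTo Φ Y Z) (f : FSeries) :
    lieDeriv Y (subst Φ f) = subst Φ (lieDeriv Z f) := by
  have hs := hasSubst_of_constantCoeff_zero hΦ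
  have e : subst Φ (lieDeriv Z f) = ∑ k, lieDeriv Y (Φ k) * subst Φ (pderiv ℂ k f) := by
    rw [lieDeriv, ← substAlgHom_apply hs, map_sum]
    refine Finset.sum_congr rfl fun k _ => ?_
    rw [substAlgHom_apply, subst_mul hs, ← h k]
  rw [e]
  simp only [lieDeriv, pderiv_subst hΦ, Finset.mul_sum, Finset.sum_mul]
  rw [Finset.sum_comm]
  exact Finset.sum_congr rfl fun k _ => Finset.sum_congr rfl fun j _ => by ring

theorem jacobianAtZero_subst {Φ Ψ : Fin 3 → FSeries} (hΦ : ∀ i, constantCoeff (Φ i) = 0) :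
    jacobianAtZero (fun i => subst Φ (Ψ i)) = jacobianAtZero Ψ * jacobianAtZero Φ := by
  ext i j
  simp [jacobianAtZero, Matrix.mul_apply, pderiv_subst hΦ,
    constantCoeff_subst_of_constantCoeff_zero hΦ]

/-- The linear parts at the origin of conjugate singular vector fields are similar. -/
theorem jacobianAtZero_conj {Φ : Fin 3 → FSeries} (hΦ : ∀ i, constantCoeff (Φ i) = 0)
    {Y Z : FVectorField} (hY : IsSingularField Y) (h : PushesForwardTo Φ Y Z) :
    jacobianAtZero Φ * jacobianAtZero Y = jacobianAtZero Z * jacobianAtZero Φ := by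
  have e : jacobianAtZero (fun i => lieDeriv Y (Φ i)) = jacobianAtZero (fun i => subst Φ (Z i)) :=
    congrArg _ (funext h)
  rw [← jacobianAtZero_subst hΦ, ← e]
  ext i j
  -- The second derivatives of `Φ` produced by Leibniz come multiplied by `Y k`, which vanishes at
  -- the origin.
  have hY' : ∀ k, constantCoeff (Y k) = 0 := fun k => RingHom.mem_ker.1 (hY k)
  simp only [jacobianAtZero, Matrix.mul_apply, Matrix.of_apply, lieDeriv, map_sum,
    Derivation.leibniz, smul_eq_mul, map_add, map_mul, hY', zero_mul, zero_add]

/-- The trace itself is zero for every prepared field; the trace of the square is the simplest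
similarity invariant that recovers the parameter up to sign. -/
theorem trace_jacobianAtZero_sq_conj {Φ : Fin 3 → FSeries} (hΦ : IsFiberedDiffeo Φ)
    {Y Z : FVectorField} (hY : IsSingularField Y) (h : PushesForwardTo Φ Y Z) :
    (jacobianAtZero Z ^ 2).trace = (jacobianAtZero Y ^ 2).trace := by
  obtain ⟨U, hU⟩ := hΦ.1.2
  have e := jacobianAtZero_conj hΦ.1.1 hY h
  rw [← hU] at e
  have e' : jacobianAtZero Z = U * jacobianAtZero Y * (U⁻¹ : (Matrix (Fin 3) (Fin 3) ℂ)ˣ) := by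
    rw [e, mul_assoc, Units.mul_inv, mul_one]
  have e2 : jacobianAtZero Z ^ 2 =
      U * (jacobianAtZero Y ^ 2 * (U⁻¹ : (Matrix (Fin 3) (Fin 3) ℂ)ˣ)) := by
    simp only [e', pow_two, mul_assoc, Units.inv_mul_cancel_left]
  rw [e2, Matrix.trace_mul_comm, mul_assoc, Units.inv_mul, mul_one]

theorem trace_jacobianAtZero_sq_of_prepared {l : ℂ} {Z : FVectorField}
    (h : IsPreparedSaddleNode l Z) : (jacobianAtZero Z ^ 2).trace = 2 * l ^ 2 := by
  obtain ⟨-, F₁, F₂, h₁, h₂, rfl⟩ := h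
  have k₁ : ∀ j, constantCoeff (pderiv ℂ j F₁) = 0 := fun j =>
    VanishesBelow.one_iff.1 ((VanishesBelow.of_mem_maxIdeal_sq h₁).pderiv j)
  have k₂ : ∀ j, constantCoeff (pderiv ℂ j F₂) = 0 := fun j =>
    VanishesBelow.one_iff.1 ((VanishesBelow.of_mem_maxIdeal_sq h₂).pderiv j)
  simp [pow_two, Matrix.trace, Matrix.mul_apply, Fin.sum_univ_three, jacobianAtZero, k₁, k₂,
    pderiv_X]
  ring

end Composition

/-! ### Triangular systems with infinitely many unknowns. -/

/-- A triangular system of equations, in which the equation of index `i` is affine in the unknown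
of index `i` with nonzero slope and involves otherwise only unknowns of smaller weight, has a
solution. -/
theorem exists_solution_of_triangular {I : Type*} (w : I → ℕ) (S : Set I)
    (E : (I → ℂ) → I → ℂ) (d : I → ℂ) (hd : ∀ i ∈ S, d i ≠ 0)
    (hE : ∀ i ∈ S, ∀ u v : I → ℂ, (∀ j, w j < w i → u j = v j) →
      E u i - E v i = d i * (u i - v i)) :
    ∃ u : I → ℂ, ∀ i ∈ S, E u i = 0 := by
  classical
  -- Solving the `i`-th equation for its own unknown: the value at `i` depends only on unknowns of
  -- smaller weight, so the iterates of `T` are constant at `i` after `w i + 1` steps.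
  let T : (I → ℂ) → I → ℂ := fun u i => if i ∈ S then u i - E u i / d i else 0
  have hT : ∀ i (u v : I → ℂ), (∀ j, w j < w i → u j = v j) → T u i = T v i := by
    intro i u v h
    by_cases hi : i ∈ S
    · have h1 := hE i hi u v h
      have h2 := hd i hi
      simp only [T, if_pos hi]
      field_simp
      linear_combination -h1
    · simp only [T, if_neg hi]
  have hstep : ∀ n i, w i < n → T^[n + 1] 0 i = T^[n] 0 i := by
    intro n
    induction n with
    | zero => intro i hi; omega
    | succ n ih =>
      intro i hi
      rw [Function.iterate_succ_apply', Function.iterate_succ_apply' T n]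
      refine hT i _ _ fun j hj => ?_
      have h := ih j (by omega)
      rwa [Function.iterate_succ_apply'] at h
  have hstab : ∀ i n, w i < n → T^[n] 0 i = T^[w i + 1] 0 i := by
    intro i n hn
    induction n, hn using Nat.le_induction with
    | base => rfl
    | succ n hn ih => rw [hstep n i hn, ih]
  refine ⟨fun i => T^[w i + 1] 0 i, fun i hi => ?_⟩
  have h1 : T (fun i => T^[w i + 1] 0 i) i = T^[w i + 1] 0 i := by
    rw [Function.iterate_succ_apply']
    exact hT i _ _ fun j hj => (hstab j _ hj).symm
  have h2 := hd i hi
  simp only [T, if_pos hi, sub_eq_self, div_eq_zero_iff, h2, or_false] at h1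
  exact h1

/-! ### Charge grading and the action of a prepared field on it. -/

section Charge

open MvPowerSeries

/-- The signs of the eigenvalues in the two directions `y₁`, `y₂`. -/
def eigenSign : Fin 2 → ℤ := ![-1, 1]

/-- The charge of the monomial `x ^ d₀ y₁ ^ d₁ y₂ ^ d₂`, its eigenvalue under
`-y₁ ∂_{y₁} + y₂ ∂_{y₂}`. -/
def charge (d : Fin 3 →₀ ℕ) : ℤ := d 2 - d 1

theorem charge_add (d e : Fin 3 →₀ ℕ) : charge (d + e) = charge d + charge e := by
  simp only [charge, Finsupp.add_apply]
  push_cast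
  ring

theorem charge_single_zero (n : ℕ) : charge (Finsupp.single 0 n) = 0 := by
  simp [charge]

theorem charge_single_succ (j : Fin 2) :
    charge (Finsupp.single j.succ 1) = eigenSign j := by
  fin_cases j <;> simp [charge, eigenSign]

theorem degree_fin_three (d : Fin 3 →₀ ℕ) : d.degree = d 0 + d 1 + d 2 := by
  rw [Finsupp.degree_eq_sum, Fin.sum_univ_three]

theorem coeff_X_mul_of_eq_zero {i : Fin 3} (f : FSeries) {m : Fin 3 →₀ ℕ} (h : m i = 0) :
    coeff m (X i * f) = 0 := by
  rw [X_def, coeff_monomial_mul, if_neg]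
  intro h'
  simpa [h] using h' i

theorem coeff_add_single_X_mul (i : Fin 3) (f : FSeries) (m : Fin 3 →₀ ℕ) :
    coeff (m + Finsupp.single i 1) (X i * f) = coeff m f := by
  rw [X_def, add_comm, coeff_add_monomial_mul, one_mul]

theorem coeff_X_mul_pderiv (i : Fin 3) (f : FSeries) (d : Fin 3 →₀ ℕ) :
    coeff d (X i * pderiv ℂ i f) = d i * coeff d f := by
  by_cases h : d i = 0
  · rw [h, Nat.cast_zero, zero_mul, coeff_X_mul_of_eq_zero _ h]
  · have h' : Finsupp.single i 1 ≤ d := by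
      rw [Finsupp.single_le_iff]; omega
    obtain ⟨e, rfl⟩ := exists_add_of_le h'
    rw [add_comm, coeff_add_single_X_mul, coeff_pderiv]
    simp [mul_comm]

/-- A vector field component of order two without resonant quadratic terms does not contribute to
the coefficients of degree `n + 1` and charge `c` of the Lie derivative of a series of order `n` whose
part of degree `n` has charge `c`. -/
theorem coeff_mul_pderiv_eq_zero {G δ : FSeries} {n : ℕ} {c : ℤ} (j : Fin 2)
    (hG : VanishesBelow 2 G)
    (hG' : ∀ d : Fin 3 →₀ ℕ, d.degree = 2 → charge d = eigenSign j → coeff d G = 0)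
    (hδ : VanishesBelow n δ)
    (hδ' : ∀ d : Fin 3 →₀ ℕ, d.degree = n → charge d ≠ c → coeff d δ = 0)
    {m : Fin 3 →₀ ℕ} (hm : m.degree = n + 1) (hc : charge m = c) :
    coeff m (G * pderiv ℂ j.succ δ) = 0 := by
  rw [coeff_mul]
  refine Finset.sum_eq_zero fun p hp => ?_
  have hp' := Finset.HasAntidiagonal.mem_antidiagonal.1 hp
  have hdeg : p.1.degree + p.2.degree = m.degree := by rw [← hp', map_add]
  have hch : charge p.1 + charge p.2 = charge m := by rw [← hp', charge_add]
  have hd2 : (p.2 + Finsupp.single j.succ 1).degree = p.2.degree + 1 := by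
    rw [map_add, Finsupp.degree_single]
  have hc2 : charge (p.2 + Finsupp.single j.succ 1) = charge p.2 + eigenSign j := by
    rw [charge_add, charge_single_succ]
  rw [coeff_pderiv]
  rcases lt_trichotomy p.1.degree 2 with h | h | h
  · rw [hG _ h, zero_mul]
  · by_cases h' : charge p.1 = eigenSign j
    · rw [hG' _ h h', zero_mul]
    -- The monomial of `δ` being differentiated has degree `n`, and its charge differs from `c`
    -- because that of `p.1` is not `eigenSign j`.
    · rw [hδ' _ (by omega) (by omega), zero_mul, mul_zero]
  · rw [hδ _ (by omega), zero_mul, mul_zero]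

/-- The prepared field with eigenvalues `0, -l, l` and higher order terms `F`. -/
noncomputable def preparedField (l : ℂ) (F : Fin 2 → FSeries) : FVectorField :=
  Fin.cons (X 0 ^ 2) fun j => ((eigenSign j : ℂ) * l) • X j.succ + F j

/-- The coefficient of the resonant monomial `x y_j` in the `y_j`-component. -/
noncomputable def resonantCoeff (F : Fin 2 → FSeries) (j : Fin 2) : ℂ :=
  coeff (Finsupp.single 0 1 + Finsupp.single j.succ 1) (F j)

/-- The part of the higher order terms other than `x y_j`. -/
noncomputable def nonresonantPart (F : Fin 2 → FSeries) (j : Fin 2) : FSeries :=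
  F j - resonantCoeff F j • (X 0 * X j.succ)

/-- The part of degree at least one of the Lie derivative along a prepared field. -/
noncomputable def higherLie (F : Fin 2 → FSeries) (f : FSeries) : FSeries :=
  X 0 ^ 2 * pderiv ℂ 0 f + ∑ j, F j * pderiv ℂ j.succ f

variable {l : ℂ} {F : Fin 2 → FSeries}

theorem lieDeriv_sub (Y : FVectorField) (f g : FSeries) :
    lieDeriv Y (f - g) = lieDeriv Y f - lieDeriv Y g := by
  simp [lieDeriv, mul_sub, Finset.sum_sub_distrib]

theorem lieDeriv_add (Y : FVectorField) (f g : FSeries) :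
    lieDeriv Y (f + g) = lieDeriv Y f + lieDeriv Y g := by
  simp [lieDeriv, mul_add, Finset.sum_add_distrib]

theorem lieDeriv_X (Y : FVectorField) (i : Fin 3) : lieDeriv Y (X i) = Y i := by
  rw [lieDeriv, Finset.sum_eq_single i]
  · simp
  · intro k _ hk
    rw [pderiv_X_of_ne hk.symm, mul_zero]
  · simp

theorem lieDeriv_preparedField (f : FSeries) :
    lieDeriv (preparedField l F) f =
      l • (X 2 * pderiv ℂ 2 f - X 1 * pderiv ℂ 1 f) + higherLie F f := by
  rw [lieDeriv, Fin.sum_univ_succ]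
  simp only [preparedField, higherLie, Fin.sum_univ_two, Fin.cons_zero, Fin.cons_succ,
    smul_eq_C_mul, eigenSign, Fin.succ_zero_eq_one, Fin.succ_one_eq_two, Matrix.cons_val_zero,
    Matrix.cons_val_one, Int.cast_neg, Int.cast_one, neg_mul, one_mul, map_neg]
  ring

theorem coeff_lieDeriv_preparedField (f : FSeries) (m : Fin 3 →₀ ℕ) :
    coeff m (lieDeriv (preparedField l F) f) =
      l * charge m * coeff m f + coeff m (higherLie F f) := by
  rw [lieDeriv_preparedField, map_add, map_smul, map_sub, coeff_X_mul_pderiv,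
    coeff_X_mul_pderiv, charge]
  push_cast
  simp only [smul_eq_mul]
  ring

theorem higherLie_vanishesBelow (hF : ∀ j, VanishesBelow 2 (F j)) {n : ℕ} {f : FSeries}
    (hf : VanishesBelow n f) : VanishesBelow (n + 1) (higherLie F f) := by
  rcases n with _ | n
  · refine VanishesBelow.add ?_ (VanishesBelow.sum fun j _ => ?_)
    · rw [mul_comm]
      exact (((VanishesBelow.X 0).pow 2).mono (by omega)).mul_left _
    · rw [mul_comm]
      exact ((hF j).mono (by omega)).mul_left _
  · refine VanishesBelow.add ?_ (VanishesBelow.sum fun j _ => ?_)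
    · exact (((VanishesBelow.X 0).pow 2).mul (hf.pderiv 0)).mono (by omega)
    · exact ((hF j).mul (hf.pderiv _)).mono (by omega)

theorem nonresonantPart_vanishesBelow (hF : ∀ j, VanishesBelow 2 (F j)) (j : Fin 2) :
    VanishesBelow 2 (nonresonantPart F j) :=
  (hF j).sub (((VanishesBelow.X 0).mul (VanishesBelow.X j.succ)).smul _)

/-- The charge is odd, so the degree in `y` is odd too; in degree two it is one, which leaves a
single factor `x`. -/
theorem eq_single_add_single_of_charge {j : Fin 2} {d : Fin 3 →₀ ℕ} (h2 : d.degree = 2)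
    (hc : charge d = eigenSign j) : d = Finsupp.single 0 1 + Finsupp.single j.succ 1 := by
  rw [degree_fin_three] at h2
  rw [charge] at hc
  ext i
  fin_cases j <;> fin_cases i <;> simp [eigenSign] at hc ⊢ <;> omega

theorem coeff_nonresonantPart_resonant (F : Fin 2 → FSeries) (j : Fin 2) :
    coeff (Finsupp.single 0 1 + Finsupp.single j.succ 1) (nonresonantPart F j) = 0 := by
  rw [nonresonantPart, map_sub, map_smul, mul_comm, coeff_add_single_X_mul]
  simp [resonantCoeff]

theorem coeff_nonresonantPart {j : Fin 2} {d : Fin 3 →₀ ℕ} (h2 : d.degree = 2)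
    (hc : charge d = eigenSign j) : coeff d (nonresonantPart F j) = 0 := by
  rw [eq_single_add_single_of_charge h2 hc, coeff_nonresonantPart_resonant]

theorem higherLie_eq (f : FSeries) :
    higherLie F f = X 0 * (X 0 * pderiv ℂ 0 f +
      ∑ j, resonantCoeff F j • (X j.succ * pderiv ℂ j.succ f)) +
      ∑ j, nonresonantPart F j * pderiv ℂ j.succ f := by
  simp only [higherLie, nonresonantPart, Fin.sum_univ_two, smul_eq_C_mul]
  ring

/-- The action of the degree one part on the resonant leading part of a series. -/
theorem coeff_higherLie_of_resonant (hF : ∀ j, VanishesBelow 2 (F j)) {δ : FSeries} {n : ℕ} {c : ℤ}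
    (hδ : VanishesBelow n δ)
    (hδ' : ∀ d : Fin 3 →₀ ℕ, d.degree = n → charge d ≠ c → coeff d δ = 0)
    {m : Fin 3 →₀ ℕ} (hm : m.degree = n + 1) (hc : charge m = c) :
    coeff m (higherLie F δ) = coeff m (X 0 * (X 0 * pderiv ℂ 0 δ +
      ∑ j, resonantCoeff F j • (X j.succ * pderiv ℂ j.succ δ))) := by
  rw [higherLie_eq, map_add, map_sum (coeff m) (fun j => nonresonantPart F j * _),
    Finset.sum_eq_zero (s := Finset.univ) (f := fun j => coeff m (nonresonantPart F j * _)),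
    add_zero]
  exact fun j _ => coeff_mul_pderiv_eq_zero j (nonresonantPart_vanishesBelow hF j)
    (fun d hd hd' => coeff_nonresonantPart hd hd') hδ hδ' hm hc

theorem coeff_add_single_zero_mul (f : FSeries) (m : Fin 3 →₀ ℕ) :
    coeff (m + Finsupp.single 0 1) (X 0 * (X 0 * pderiv ℂ 0 f +
      ∑ j, resonantCoeff F j • (X j.succ * pderiv ℂ j.succ f))) =
      (m 0 + ∑ j : Fin 2, resonantCoeff F j * m j.succ) * coeff m f := by
  rw [coeff_add_single_X_mul, map_add, map_sum, coeff_X_mul_pderiv, add_mul, Finset.sum_mul]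
  congr 1
  refine Finset.sum_congr rfl fun j _ => ?_
  rw [map_smul, coeff_X_mul_pderiv, smul_eq_mul, mul_assoc]

end Charge

/-! ### Substitution into one-variable series, and resonant monomials. -/

section Resonant

open MvPowerSeries

theorem coeff_powerSeries_subst_congr {a b : FSeries} (ha : constantCoeff a = 0)
    (hb : constantCoeff b = 0) (c : PowerSeries ℂ) {e : Fin 3 →₀ ℕ}
    (h : ∀ q, PowerSeries.coeff q c = 0 ∨ coeff e (a ^ q) = coeff e (b ^ q)) :
    coeff e (PowerSeries.subst a c) = coeff e (PowerSeries.subst b c) := by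
  rw [PowerSeries.coeff_subst (PowerSeries.HasSubst.of_constantCoeff_zero ha),
    PowerSeries.coeff_subst (PowerSeries.HasSubst.of_constantCoeff_zero hb)]
  refine finsum_congr fun q => ?_
  rcases h q with h | h
  · rw [h, zero_smul, zero_smul]
  · rw [h]

theorem VanishesBelow.powerSeries_subst_sub {a b : FSeries} {n : ℕ} (ha : constantCoeff a = 0)
    (hb : constantCoeff b = 0) (h : VanishesBelow n (a - b)) (c : PowerSeries ℂ) :
    VanishesBelow n (PowerSeries.subst a c - PowerSeries.subst b c) := by
  intro e he
  rw [map_sub, sub_eq_zero]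
  refine coeff_powerSeries_subst_congr ha hb c fun q => Or.inr ?_
  obtain ⟨t, ht⟩ := sub_dvd_pow_sub_pow a b q
  rw [← sub_eq_zero, ← map_sub, ht, mul_comm]
  exact h.mul_left t e he

theorem VanishesBelow.pow_sub_pow {a b : FSeries} (ha : VanishesBelow 2 a) (hb : VanishesBelow 2 b)
    (h : VanishesBelow 3 (a - b)) (q : ℕ) : VanishesBelow (2 * q + 1) (a ^ q - b ^ q) := by
  induction q with
  | zero => intro e _; simp
  | succ q ih =>
    have e : a ^ (q + 1) - b ^ (q + 1) = a ^ q * (a - b) + (a ^ q - b ^ q) * b := by ring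
    rw [e]
    exact (((ha.pow q).mul h).mono (by omega)).add ((ih.mul hb).mono (by omega))

theorem VanishesBelow.powerSeries_subst {a : FSeries} (ha : VanishesBelow 2 a) {c : PowerSeries ℂ}
    {k : ℕ} (hc : ∀ q, 2 * q < k → PowerSeries.coeff q c = 0) :
    VanishesBelow k (PowerSeries.subst a c) := by
  intro e he
  have ha' : constantCoeff a = 0 := one_iff.1 (ha.mono (by omega))
  rw [PowerSeries.coeff_subst (PowerSeries.HasSubst.of_constantCoeff_zero ha')]
  refine finsum_eq_zero_of_forall_eq_zero fun q => ?_
  by_cases h : 2 * q < k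
  · rw [hc q h, zero_smul]
  · rw [ha.pow q e (by omega), smul_zero]

/-- Lets `φ₁ φ₂` be replaced by `y₁ y₂` in the leading term: the two agree through degree two, so
their `q`-th powers agree through degree `2 q`. -/
theorem VanishesBelow.powerSeries_subst_sub_leading {a b : FSeries} (ha : VanishesBelow 2 a)
    (hb : VanishesBelow 2 b) (h : VanishesBelow 3 (a - b)) {c : PowerSeries ℂ} {k : ℕ}
    (hc : ∀ q, 2 * q < k → PowerSeries.coeff q c = 0) :
    VanishesBelow (k + 1) (PowerSeries.subst a c - PowerSeries.subst b c) := by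
  intro e he
  rw [map_sub, sub_eq_zero]
  refine coeff_powerSeries_subst_congr (one_iff.1 (ha.mono (by omega)))
    (one_iff.1 (hb.mono (by omega))) c fun q => ?_
  by_cases hq : 2 * q < k
  · exact Or.inl (hc q hq)
  · right
    rw [← sub_eq_zero, ← map_sub]
    exact ha.pow_sub_pow hb h q e (by omega)

/-- The exponent of the monomial `(y₁ y₂) ^ q`. -/
noncomputable def balanced (q : ℕ) : Fin 3 →₀ ℕ := Finsupp.single 1 q + Finsupp.single 2 q

theorem balanced_apply_zero (q : ℕ) : balanced q 0 = 0 := by simp [balanced]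

theorem X_mul_X_pow (q : ℕ) :
    (X 1 * X 2 : FSeries) ^ q = monomial (balanced q) 1 := by
  rw [mul_pow, X_pow_eq, X_pow_eq, monomial_mul_monomial, one_mul, balanced]

theorem constantCoeff_X_mul_X : constantCoeff (X 1 * X 2 : FSeries) = 0 := by simp

theorem coeff_balanced_subst (q : ℕ) (c : PowerSeries ℂ) :
    coeff (balanced q) (PowerSeries.subst (X 1 * X 2 : FSeries) c) = PowerSeries.coeff q c := by
  rw [PowerSeries.coeff_subst (PowerSeries.HasSubst.of_constantCoeff_zero constantCoeff_X_mul_X),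
    finsum_eq_single _ q]
  · rw [X_mul_X_pow, coeff_monomial_same, smul_eq_mul, mul_one]
  · intro p hp
    rw [X_mul_X_pow, coeff_monomial_ne, smul_zero]
    intro h
    apply hp
    have := DFunLike.congr_fun h 1
    simpa [balanced] using this.symm

theorem coeff_subst_X_mul_X_eq_zero (c : PowerSeries ℂ) {e : Fin 3 →₀ ℕ} (he : e 0 ≠ 0) :
    coeff e (PowerSeries.subst (X 1 * X 2 : FSeries) c) = 0 := by
  rw [PowerSeries.coeff_subst (PowerSeries.HasSubst.of_constantCoeff_zero constantCoeff_X_mul_X)]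
  refine finsum_eq_zero_of_forall_eq_zero fun p => ?_
  rw [X_mul_X_pow, coeff_monomial_ne, smul_zero]
  rintro rfl
  exact he (balanced_apply_zero p)

/-- Every resonant monomial is `x ^ k (y₁ y₂) ^ q y_j`. -/
theorem exists_of_charge_eq {j : Fin 2} {m : Fin 3 →₀ ℕ} (h : charge m = eigenSign j) :
    ∃ k q, m = Finsupp.single 0 k + balanced q + Finsupp.single j.succ 1 := by
  refine ⟨m 0, min (m 1) (m 2), ?_⟩
  rw [charge] at h
  ext i
  fin_cases j <;> fin_cases i <;> simp [eigenSign, balanced] at h ⊢ <;> omega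

theorem degree_balanced (q : ℕ) : (balanced q).degree = 2 * q := by
  rw [balanced, map_add, Finsupp.degree_single, Finsupp.degree_single]
  ring

theorem charge_balanced (q : ℕ) : charge (balanced q) = 0 := by
  simp [charge, balanced]

end Resonant

/-! ### The normalization problem as a triangular system. -/

section System

open MvPowerSeries

/-- The unknowns of the normalization problem, indexed by its scalar equations. -/
abbrev Unknowns : Type := Fin 2 × (Fin 3 →₀ ℕ) → ℂ

/-- The higher order part of the `j`-th component of the normalizing map. -/
noncomputable def higherPart (u : Unknowns) (j : Fin 2) : FSeries := fun m =>
  if m.degree ≤ 1 then 0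
  -- An unknown carries the index of the equation that determines it; for a resonant coefficient of
  -- `φ_j` that equation lies one power of `x` higher.
  else if charge m = eigenSign j then u (j, m + Finsupp.single 0 1) else u (j, m)

/-- The `j`-th component of the normalizing map. -/
noncomputable def normalizer (u : Unknowns) (j : Fin 2) : FSeries := X j.succ + higherPart u j

/-- The series `c_j` of the normal form. -/
noncomputable def normalSeries (u : Unknowns) (j : Fin 2) : PowerSeries ℂ :=
  -- These indices are resonant without `x`, hence distinct from all those used in `higherPart`.
  PowerSeries.mk fun q => if q = 0 then 0 else u (j, balanced q + Finsupp.single j.succ 1)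

/-- The defect of the `j`-th component of the conjugacy equation. -/
noncomputable def defect (l : ℂ) (F : Fin 2 → FSeries) (u : Unknowns) (j : Fin 2) : FSeries :=
  lieDeriv (preparedField l F) (normalizer u j) - ((eigenSign j : ℂ) * l) • normalizer u j -
    resonantCoeff F j • (X 0 * normalizer u j) -
    PowerSeries.subst (normalizer u 0 * normalizer u 1) (normalSeries u j) * normalizer u j

/-- The weight of an unknown. -/
noncomputable def unknownWeight (i : Fin 2 × (Fin 3 →₀ ℕ)) : ℕ :=
  -- In each degree the resonant equations are solved before the nonresonant ones. A resonant
  -- coefficient of `φ_j` of degree `n` thus has weight `2 n + 2`, just after the nonresonant ones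
  -- of degree `n`.
  if charge i.2 = eigenSign i.1 then 2 * i.2.degree else 2 * i.2.degree + 1

/-- The diagonal coefficient of the normalization problem. -/
noncomputable def diagonalCoeff (l : ℂ) (F : Fin 2 → FSeries) (i : Fin 2 × (Fin 3 →₀ ℕ)) : ℂ :=
  if charge i.2 = eigenSign i.1 then
    if i.2 0 = 0 then -1
    -- The `- 1` undoes the shift by `x`: the coefficient being determined sits at `i.2` divided by
    -- `x`.
    else (i.2 0 - 1 : ℂ) + ∑ k : Fin 2, resonantCoeff F k * i.2 k.succ - resonantCoeff F i.1
  else l * (charge i.2 - eigenSign i.1)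

/-- The equations that determine an unknown; the others hold for every choice of the unknowns. -/
def effectiveEquations : Set (Fin 2 × (Fin 3 →₀ ℕ)) :=
  {i | 2 ≤ i.2.degree ∧ i.2 ≠ Finsupp.single 0 1 + Finsupp.single i.1.succ 1}

variable {l : ℂ} {F : Fin 2 → FSeries} {u v : Unknowns} {j : Fin 2}

theorem coeff_higherPart (u : Unknowns) (j : Fin 2) (m : Fin 3 →₀ ℕ) :
    coeff m (higherPart u j) = if m.degree ≤ 1 then 0
      else if charge m = eigenSign j then u (j, m + Finsupp.single 0 1) else u (j, m) := rfl

theorem higherPart_vanishesBelow (u : Unknowns) (j : Fin 2) : VanishesBelow 2 (higherPart u j) :=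
  fun m hm => by rw [coeff_higherPart, if_pos (by omega)]

theorem normalizer_vanishesBelow (u : Unknowns) (j : Fin 2) : VanishesBelow 1 (normalizer u j) :=
  (VanishesBelow.X _).add ((higherPart_vanishesBelow u j).mono (by omega))

theorem normalizer_mul_vanishesBelow (u : Unknowns) :
    VanishesBelow 2 (normalizer u 0 * normalizer u 1) :=
  (normalizer_vanishesBelow u 0).mul (normalizer_vanishesBelow u 1)

theorem normalizer_mul_sub_vanishesBelow (u : Unknowns) :
    VanishesBelow 3 (normalizer u 0 * normalizer u 1 - X 1 * X 2) := by
  have e : normalizer u 0 * normalizer u 1 - X 1 * X 2 =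
      higherPart u 0 * normalizer u 1 + X 1 * higherPart u 1 := by
    simp only [normalizer, Fin.succ_zero_eq_one, Fin.succ_one_eq_two]
    ring
  rw [e]
  exact ((higherPart_vanishesBelow u 0).mul (normalizer_vanishesBelow u 1)).add
    ((VanishesBelow.X 1).mul (higherPart_vanishesBelow u 1))

theorem coeff_normalSeries_zero (u : Unknowns) (j : Fin 2) :
    PowerSeries.coeff 0 (normalSeries u j) = 0 := by
  simp [normalSeries]

theorem diagonalCoeff_ne_zero (hl : l ≠ 0)
    (hr : ∀ q : ℚ, q ≤ 0 → resonantCoeff F 0 + resonantCoeff F 1 ≠ (q : ℂ))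
    {i : Fin 2 × (Fin 3 →₀ ℕ)} (hi : i ∈ effectiveEquations) : diagonalCoeff l F i ≠ 0 := by
  obtain ⟨j, m⟩ := i
  obtain ⟨-, h2⟩ := hi
  unfold diagonalCoeff
  dsimp only at h2 ⊢
  split_ifs with hc h0
  · norm_num
  · obtain ⟨k, q, rfl⟩ := exists_of_charge_eq hc
    have hk0 : k ≠ 0 := by
      rintro rfl
      apply h0
      simp [balanced_apply_zero]
    obtain ⟨k, rfl⟩ := Nat.exists_eq_succ_of_ne_zero hk0
    have e : (((Finsupp.single 0 (k + 1) + balanced q + Finsupp.single j.succ 1 :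
        Fin 3 →₀ ℕ) 0 : ℕ) : ℂ) - 1 +
        ∑ i : Fin 2, resonantCoeff F i *
          ((Finsupp.single 0 (k + 1) + balanced q + Finsupp.single j.succ 1 :
            Fin 3 →₀ ℕ) i.succ : ℕ) - resonantCoeff F j =
        k + q * (resonantCoeff F 0 + resonantCoeff F 1) := by
      fin_cases j <;> simp [Fin.sum_univ_two, balanced] <;> ring
    rw [e]
    intro h
    by_cases hq : q = 0
    · subst hq
      have hk : k = 0 := by simpa using h
      subst hk
      exact h2 (by simp [balanced])
    · have hq' : (q : ℂ) ≠ 0 := Nat.cast_ne_zero.2 hq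
      refine hr (-(k : ℚ) / q) (div_nonpos_of_nonpos_of_nonneg (by simp) (by simp)) ?_
      push_cast
      field_simp
      linear_combination h
  · refine mul_ne_zero hl ?_
    rw [sub_ne_zero]
    exact_mod_cast hc

/-- The linear terms agree because the map is tangent to the identity. At `x y_j`, subtracting `a_j
x y_j` cancels the coefficient of `F j`, and the coefficient of `higherPart` there is multiplied by
a zero charge difference. -/
theorem coeff_defect_eq_zero (hF : ∀ j, VanishesBelow 2 (F j)) (u : Unknowns)
    {m : Fin 3 →₀ ℕ} (hm : (j, m) ∉ effectiveEquations) : coeff m (defect l F u j) = 0 := by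
  have h1 : lieDeriv (preparedField l F) (normalizer u j) =
      ((eigenSign j : ℂ) * l) • X j.succ + F j +
        lieDeriv (preparedField l F) (higherPart u j) := by
    rw [normalizer, lieDeriv_add, lieDeriv_X]
    rfl
  have h2 : defect l F u j = nonresonantPart F j +
      (lieDeriv (preparedField l F) (higherPart u j) -
        ((eigenSign j : ℂ) * l) • higherPart u j) -
      (resonantCoeff F j • (X 0 * higherPart u j) +
        PowerSeries.subst (normalizer u 0 * normalizer u 1) (normalSeries u j) *
          normalizer u j) := by
    rw [defect, h1, nonresonantPart]
    simp only [normalizer, smul_eq_C_mul]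
    ring
  have h3 : VanishesBelow 3 (resonantCoeff F j • (X 0 * higherPart u j) +
        PowerSeries.subst (normalizer u 0 * normalizer u 1) (normalSeries u j) *
          normalizer u j) := by
    refine (((VanishesBelow.X 0).mul (higherPart_vanishesBelow u j)).smul _).add
      (VanishesBelow.mul (n := 2) (k := 1) ?_ (normalizer_vanishesBelow u j))
    refine (normalizer_mul_vanishesBelow u).powerSeries_subst fun q hq => ?_
    obtain rfl : q = 0 := by omega
    exact coeff_normalSeries_zero u j
  have h4 : VanishesBelow 3 (higherLie F (higherPart u j)) :=
    higherLie_vanishesBelow hF (higherPart_vanishesBelow u j)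
  have hdeg : m.degree < 2 ∨ m = Finsupp.single 0 1 + Finsupp.single j.succ 1 := by
    by_contra h
    rw [not_or] at h
    exact hm ⟨not_lt.1 h.1, h.2⟩
  have hdeg' : m.degree < 3 := by
    rcases hdeg with h | rfl
    · omega
    · simp [map_add, Finsupp.degree_single]
  rw [h2, map_sub, h3 m hdeg', sub_zero, map_add, map_sub, coeff_lieDeriv_preparedField,
    h4 m hdeg', map_smul, smul_eq_mul, add_zero]
  rcases hdeg with h | rfl
  · rw [nonresonantPart_vanishesBelow hF j m h, higherPart_vanishesBelow u j m h]
    ring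
  · rw [coeff_nonresonantPart_resonant, charge_add, charge_single_zero, charge_single_succ]
    push_cast
    ring

/-- Separates the part linear in the differences of the unknowns from a last bracket that is of
higher order when these differences are small. -/
theorem defect_sub_defect (u v : Unknowns) (j : Fin 2) :
    defect l F u j - defect l F v j =
      (lieDeriv (preparedField l F) (higherPart u j - higherPart v j) -
        ((eigenSign j : ℂ) * l) • (higherPart u j - higherPart v j)) -
      resonantCoeff F j • (X 0 * (higherPart u j - higherPart v j)) -
      PowerSeries.subst (X 1 * X 2 : FSeries) (normalSeries u j - normalSeries v j) * X j.succ -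
      (PowerSeries.subst (normalizer u 0 * normalizer u 1) (normalSeries u j) *
          (higherPart u j - higherPart v j) +
        (PowerSeries.subst (normalizer u 0 * normalizer u 1) (normalSeries v j) -
          PowerSeries.subst (normalizer v 0 * normalizer v 1) (normalSeries v j)) *
          normalizer v j +
        (PowerSeries.subst (normalizer u 0 * normalizer u 1)
            (normalSeries u j - normalSeries v j) -
          PowerSeries.subst (X 1 * X 2 : FSeries) (normalSeries u j - normalSeries v j)) *
          normalizer v j +
        PowerSeries.subst (X 1 * X 2 : FSeries) (normalSeries u j - normalSeries v j) *
          higherPart v j) := by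
  have hu : PowerSeries.HasSubst (normalizer u 0 * normalizer u 1) :=
    PowerSeries.HasSubst.of_constantCoeff_zero
      (VanishesBelow.one_iff.1 ((normalizer_mul_vanishesBelow u).mono (by omega)))
  have e : higherPart u j - higherPart v j = normalizer u j - normalizer v j := by
    simp only [normalizer]
    ring
  have e' : higherPart v j = normalizer v j - X j.succ := by
    simp only [normalizer]
    ring
  rw [PowerSeries.subst_sub hu, e, e', lieDeriv_sub, defect, defect]
  simp only [smul_eq_C_mul]
  ring

theorem coeff_defect_sub_defect {n : ℕ} {m : Fin 3 →₀ ℕ} (hm : m.degree = n + 1) (hδ : ∀ k, VanishesBelow n (higherPart u k - higherPart v k))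
    (hc : ∀ q, 2 * q < n →
      PowerSeries.coeff q (normalSeries u j) = PowerSeries.coeff q (normalSeries v j)) :
    coeff m (defect l F u j) - coeff m (defect l F v j) =
      l * (charge m - eigenSign j) * coeff m (higherPart u j - higherPart v j) +
      coeff m (higherLie F (higherPart u j - higherPart v j)) -
      resonantCoeff F j * coeff m (X 0 * (higherPart u j - higherPart v j)) -
      coeff m (PowerSeries.subst (X 1 * X 2 : FSeries) (normalSeries u j - normalSeries v j) *
        X j.succ) := by
  have hV : VanishesBelow 2 (X 1 * X 2 : FSeries) := (VanishesBelow.X 1).mul (VanishesBelow.X 2)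
  have hc' : ∀ q, 2 * q < n → PowerSeries.coeff q (normalSeries u j - normalSeries v j) = 0 :=
    fun q hq => by rw [map_sub, hc q hq, sub_self]
  have hconst : ∀ w : Unknowns, constantCoeff (normalizer w 0 * normalizer w 1) = 0 := fun w =>
    VanishesBelow.one_iff.1 ((normalizer_mul_vanishesBelow w).mono (by omega))
  have hdiff : VanishesBelow (n + 1)
      (normalizer u 0 * normalizer u 1 - normalizer v 0 * normalizer v 1) := by
    have e : normalizer u 0 * normalizer u 1 - normalizer v 0 * normalizer v 1 =
        (higherPart u 0 - higherPart v 0) * normalizer u 1 +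
          normalizer v 0 * (higherPart u 1 - higherPart v 1) := by
      simp only [normalizer]
      ring
    rw [e]
    exact ((hδ 0).mul (normalizer_vanishesBelow u 1)).add
      (((normalizer_vanishesBelow v 0).mul (hδ 1)).mono (by omega))
  have hsu : VanishesBelow 2
      (PowerSeries.subst (normalizer u 0 * normalizer u 1) (normalSeries u j)) := by
    refine (normalizer_mul_vanishesBelow u).powerSeries_subst fun q hq => ?_
    obtain rfl : q = 0 := by omega
    exact coeff_normalSeries_zero u j
  -- Each of the four terms of the bracket has order at least `n + 2`, hence does not reach degree
  -- `n + 1`.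
  have hrest := (((hsu.mul (hδ j)).mono (k := n + 2) (by omega)).add
    ((VanishesBelow.powerSeries_subst_sub (hconst u) (hconst v) hdiff (normalSeries v j)).mul
      (normalizer_vanishesBelow v j))).add
    ((VanishesBelow.powerSeries_subst_sub_leading (normalizer_mul_vanishesBelow u) hV
      (normalizer_mul_sub_vanishesBelow u) hc').mul (normalizer_vanishesBelow v j)) |>.add
    ((hV.powerSeries_subst hc').mul (higherPart_vanishesBelow v j))
  rw [← map_sub, defect_sub_defect, map_sub, hrest m (by omega), sub_zero, map_sub, map_sub,
    map_sub, coeff_lieDeriv_preparedField, map_smul, map_smul, smul_eq_mul, smul_eq_mul]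
  ring

/-- The normalization problem is triangular. -/
theorem coeff_defect_triangular (hF : ∀ j, VanishesBelow 2 (F j)) {m : Fin 3 →₀ ℕ}
    (hm : (j, m) ∈ effectiveEquations)
    (h : ∀ i, unknownWeight i < unknownWeight (j, m) → u i = v i) :
    coeff m (defect l F u j) - coeff m (defect l F v j) =
      diagonalCoeff l F (j, m) * (u (j, m) - v (j, m)) := by
  obtain ⟨hm2, hmx⟩ := hm
  dsimp only at hm2 hmx
  have hc : ∀ q, 2 * (2 * q + 1) < unknownWeight (j, m) →
      PowerSeries.coeff q (normalSeries u j) = PowerSeries.coeff q (normalSeries v j) := by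
    intro q hq
    simp only [normalSeries, PowerSeries.coeff_mk]
    split_ifs
    · rfl
    · apply h
      rw [unknownWeight, if_pos (by simp [charge_add, charge_balanced, charge_single_succ])]
      simpa [map_add, degree_balanced, Finsupp.degree_single] using hq
  have hδ : ∀ k (d : Fin 3 →₀ ℕ), (if charge d = eigenSign k then 2 * d.degree + 2
      else 2 * d.degree + 1) < unknownWeight (j, m) →
      coeff d (higherPart u k - higherPart v k) = 0 := by
    intro k d hd
    rw [map_sub, coeff_higherPart, coeff_higherPart]
    split_ifs with h1 h2
    · exact sub_self _
    · rw [if_pos h2] at hd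
      rw [h, sub_self]
      rwa [unknownWeight, if_pos (by simp [charge_add, charge_single_zero, h2]), map_add,
        Finsupp.degree_single, mul_add]
    · rw [if_neg h2] at hd
      rw [h, sub_self]
      rwa [unknownWeight, if_neg h2]
  by_cases hres : charge m = eigenSign j
  · have hw : unknownWeight (j, m) = 2 * m.degree := if_pos hres
    obtain ⟨n, hn⟩ : ∃ n, m.degree = n + 1 := ⟨m.degree - 1, by omega⟩
    rw [hw] at hc hδ
    -- The weights give more for nonresonant coefficients: they agree in degree `n` as well, so the
    -- leading part of the difference is purely resonant and the nonresonant quadratic terms of `F`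
    -- drop out.
    have hδ1 : ∀ k, VanishesBelow n (higherPart u k - higherPart v k) := fun k d hd =>
      hδ k d (by split_ifs <;> omega)
    rw [coeff_defect_sub_defect hn hδ1 fun q hq => hc q (by omega),
      coeff_higherLie_of_resonant hF (hδ1 j) (c := eigenSign j)
        (fun d hd hd' => hδ j d (by rw [if_neg hd']; omega)) hn hres, hres, sub_self, mul_zero,
      zero_mul, zero_add, diagonalCoeff, if_pos hres]
    dsimp only
    obtain ⟨k, q, hkq⟩ := exists_of_charge_eq hres
    -- Without a factor `x` the equation determines a coefficient of the normal form; with one, a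
    -- coefficient of the normalizing map.
    rcases k with _ | k
    · have h0 : m 0 = 0 := by simp [hkq, balanced_apply_zero]
      have hq : q ≠ 0 := by
        rintro rfl
        rw [hkq] at hm2
        simp [balanced, Finsupp.degree_single] at hm2
      rw [if_pos h0, coeff_X_mul_of_eq_zero _ h0, coeff_X_mul_of_eq_zero _ h0, hkq,
        Finsupp.single_zero, zero_add, mul_comm _ (X j.succ), coeff_add_single_X_mul,
        coeff_balanced_subst, map_sub]
      simp only [normalSeries, PowerSeries.coeff_mk, if_neg hq]
      ring
    · obtain ⟨m', rfl⟩ : ∃ m', m = m' + Finsupp.single 0 1 := by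
        refine ⟨Finsupp.single 0 k + balanced q + Finsupp.single j.succ 1, ?_⟩
        rw [hkq, Finsupp.single_add]
        abel
      have hm' : charge m' = eigenSign j := by
        rwa [charge_add, charge_single_zero, add_zero] at hres
      have hdeg : ¬ m'.degree ≤ 1 := by
        intro hle
        apply hmx
        refine eq_single_add_single_of_charge ?_ hres
        rw [map_add, Finsupp.degree_single] at hm2 ⊢
        omega
      have h0 : (m' + Finsupp.single 0 1 : Fin 3 →₀ ℕ) 0 = m' 0 + 1 := by simp
      have hs : ∀ i : Fin 2, (m' + Finsupp.single 0 1 : Fin 3 →₀ ℕ) i.succ = m' i.succ := by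
        intro i; simp
      have hlast : coeff (m' + Finsupp.single 0 1)
          (PowerSeries.subst (X 1 * X 2 : FSeries) (normalSeries u j - normalSeries v j) *
            X j.succ) = 0 := by
        rw [hkq, mul_comm, coeff_add_single_X_mul, coeff_subst_X_mul_X_eq_zero]
        simp [balanced_apply_zero]
      rw [if_neg (by omega), coeff_add_single_zero_mul, coeff_add_single_X_mul, hlast, map_sub,
        coeff_higherPart, coeff_higherPart, if_neg hdeg, if_pos hm', if_neg hdeg, if_pos hm', h0]
      simp only [hs]
      push_cast
      ring
  · have hw : unknownWeight (j, m) = 2 * m.degree + 1 := if_neg hres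
    obtain ⟨n, hn⟩ : ∃ n, m.degree = n + 1 := ⟨m.degree - 1, by omega⟩
    rw [hw] at hc hδ
    -- Now all coefficients of degree `n`, resonant ones included, have smaller weight, so only the
    -- term with the charge difference survives.
    have hδ1 : ∀ k, VanishesBelow (n + 1) (higherPart u k - higherPart v k) := fun k d hd =>
      hδ k d (by split_ifs <;> omega)
    have hlast : coeff m (PowerSeries.subst (X 1 * X 2 : FSeries)
        (normalSeries u j - normalSeries v j) * X j.succ) = 0 := by
      have hV : VanishesBelow 2 (X 1 * X 2 : FSeries) :=
        (VanishesBelow.X 1).mul (VanishesBelow.X 2)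
      refine (hV.powerSeries_subst (k := n + 1) fun q hq => ?_).mul (VanishesBelow.X _) m (by omega)
      rw [map_sub, hc q (by omega), sub_self]
    rw [coeff_defect_sub_defect hn (fun k => (hδ1 k).mono (by omega))
      fun q hq => hc q (by omega), higherLie_vanishesBelow hF (hδ1 j) m (by omega), hlast,
      ((VanishesBelow.X 0).mul (hδ1 j)) m (by omega), diagonalCoeff, if_neg hres, map_sub,
      coeff_higherPart, coeff_higherPart, if_neg (by omega), if_neg hres, if_neg (by omega),
      if_neg hres]
    ring

/-- Every prepared field whose residue is not a nonpositive rational number admits a normalizing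
map tangent to the identity. -/
theorem exists_normalizer (hl : l ≠ 0) (hF : ∀ j, VanishesBelow 2 (F j))
    (hr : ∀ q : ℚ, q ≤ 0 → resonantCoeff F 0 + resonantCoeff F 1 ≠ (q : ℂ)) :
    ∃ u : Unknowns, ∀ j, defect l F u j = 0 := by
  obtain ⟨u, hu⟩ := exists_solution_of_triangular unknownWeight effectiveEquations
    (fun u i => coeff i.2 (defect l F u i.1)) (diagonalCoeff l F)
    (fun i hi => diagonalCoeff_ne_zero hl hr hi)
    (fun i hi u v h => coeff_defect_triangular hF hi h)
  refine ⟨u, fun j => ?_⟩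
  ext m
  by_cases hm : (j, m) ∈ effectiveEquations
  · exact hu (j, m) hm
  · exact coeff_defect_eq_zero hF u hm

end System

/-! ### From the solved system back to conjugacy of vector fields. -/

section Conjugacy

open MvPowerSeries

theorem IsPreparedSaddleNode.exists_eq_preparedField {l : ℂ} {Z : FVectorField}
    (h : IsPreparedSaddleNode l Z) :
    ∃ F : Fin 2 → FSeries, (∀ j, VanishesBelow 2 (F j)) ∧ Z = preparedField l F := by
  obtain ⟨-, F₁, F₂, h₁, h₂, rfl⟩ := h
  refine ⟨![F₁, F₂], fun j => ?_, funext fun i => ?_⟩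
  · fin_cases j
    · exact VanishesBelow.of_mem_maxIdeal_sq h₁
    · exact VanishesBelow.of_mem_maxIdeal_sq h₂
  · fin_cases i
    · rfl
    · change _ = ((eigenSign 0 : ℂ) * l) • X 1 + F₁
      simp [eigenSign]
    · change _ = ((eigenSign 1 : ℂ) * l) • X 2 + F₂
      simp [eigenSign]

theorem preparedResidue_preparedField (l : ℂ) (F : Fin 2 → FSeries) :
    preparedResidue (preparedField l F) = resonantCoeff F 0 + resonantCoeff F 1 := by
  have h : ∀ j : Fin 2, coeff (Finsupp.single 0 1 + Finsupp.single j.succ 1)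
      (preparedField l F j.succ) = resonantCoeff F j := by
    intro j
    rw [preparedField, Fin.cons_succ, map_add, map_smul, coeff_X, if_neg, smul_zero, zero_add,
      resonantCoeff]
    intro h
    simpa using DFunLike.congr_fun h 0
  simp only [preparedResidue, linearPart, Matrix.trace, Matrix.diag, Fin.sum_univ_two,
    Matrix.of_apply, map_add, PowerSeries.coeff_mk, h]

/-- The conjugacy equations for a fibered map with values in a normal form. -/
theorem pushesForwardTo_normalForm {Y : FVectorField} {l a₁ a₂ : ℂ} {c₁ c₂ : PowerSeries ℂ}
    {φ₁ φ₂ : FSeries} (h₁ : constantCoeff φ₁ = 0) (h₂ : constantCoeff φ₂ = 0)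
    (hx : Y 0 = X 0 ^ 2)
    (e₁ : lieDeriv Y φ₁ = -l • φ₁ + a₁ • (X 0 * φ₁) + PowerSeries.subst (φ₁ * φ₂) c₁ * φ₁)
    (e₂ : lieDeriv Y φ₂ = l • φ₂ + a₂ • (X 0 * φ₂) + PowerSeries.subst (φ₁ * φ₂) c₂ * φ₂) :
    PushesForwardTo ![X 0, φ₁, φ₂] Y (normalForm l a₁ a₂ c₁ c₂) := by
  have hΦ : ∀ i, constantCoeff ((![X 0, φ₁, φ₂] : Fin 3 → FSeries) i) = 0 := by
    intro i
    fin_cases i <;> simp [h₁, h₂]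
  have hs := hasSubst_of_constantCoeff_zero hΦ
  have hc : ∀ c : PowerSeries ℂ, subst ![X 0, φ₁, φ₂] (PowerSeries.subst (X 1 * X 2 : FSeries) c) =
      PowerSeries.subst (φ₁ * φ₂) c := by
    intro c
    simp only [PowerSeries.subst]
    rw [subst_comp_subst_apply
      (PowerSeries.HasSubst.of_constantCoeff_zero constantCoeff_X_mul_X).const hs]
    simp [subst_mul hs, subst_X hs]
  intro i
  fin_cases i
  · change lieDeriv Y (X 0) = subst ![X 0, φ₁, φ₂] (X 0 ^ 2)
    rw [lieDeriv_X, hx, subst_pow hs, subst_X hs]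
    rfl
  · change lieDeriv Y φ₁ = subst ![X 0, φ₁, φ₂]
      ((C (-l) + a₁ • X 0 + PowerSeries.subst (X 1 * X 2 : FSeries) c₁) * X 1)
    rw [e₁, subst_mul hs, subst_add hs, subst_add hs, subst_smul hs, hc, subst_C, subst_X hs,
      subst_X hs]
    simp only [smul_eq_C_mul, Matrix.cons_val_zero, Matrix.cons_val_one]
    ring
  · change lieDeriv Y φ₂ = subst ![X 0, φ₁, φ₂]
      ((C l + a₂ • X 0 + PowerSeries.subst (X 1 * X 2 : FSeries) c₂) * X 2)
    rw [e₂, subst_mul hs, subst_add hs, subst_add hs, subst_smul hs, hc, subst_C, subst_X hs,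
      subst_X hs]
    simp only [smul_eq_C_mul, Matrix.cons_val_zero, Matrix.cons_val]
    ring

/-- The eigenvalue parameter of a doubly-resonant saddle-node is determined up to sign. -/
theorem eigenvalue_eq_or_eq_neg {Y Z Z' : FVectorField} {l l' : ℂ} {Φ Φ' : Fin 3 → FSeries}
    (hY : IsSingularField Y) (hΦ : IsFiberedDiffeo Φ) (h : PushesForwardTo Φ Y Z)
    (hZ : IsPreparedSaddleNode l Z) (hΦ' : IsFiberedDiffeo Φ') (h' : PushesForwardTo Φ' Y Z')
    (hZ' : IsPreparedSaddleNode l' Z') : l' = l ∨ l' = -l := by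
  have e := trace_jacobianAtZero_sq_conj hΦ hY h
  rw [← trace_jacobianAtZero_sq_conj hΦ' hY h', trace_jacobianAtZero_sq_of_prepared hZ,
    trace_jacobianAtZero_sq_of_prepared hZ'] at e
  exact sq_eq_sq_iff_eq_or_eq_neg.1 (mul_left_cancel₀ two_ne_zero e.symm)

theorem jacobianAtZero_normalizer (u : Unknowns) :
    jacobianAtZero ![X 0, normalizer u 0, normalizer u 1] = 1 := by
  have h : ∀ j k, constantCoeff (pderiv ℂ k (higherPart u j)) = 0 := fun j k =>
    VanishesBelow.one_iff.1 ((higherPart_vanishesBelow u j).pderiv k)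
  ext i k
  fin_cases i <;> fin_cases k <;> simp [jacobianAtZero, normalizer, h]

theorem isFiberedDiffeo_subst_normalizer {Φ : Fin 3 → FSeries} (hΦ : IsFiberedDiffeo Φ)
    (u : Unknowns) :
    IsFiberedDiffeo ![X 0, subst Φ (normalizer u 0), subst Φ (normalizer u 1)] := by
  have hs := hasSubst_of_constantCoeff_zero hΦ.1.1
  have e : (![X 0, subst Φ (normalizer u 0), subst Φ (normalizer u 1)] : Fin 3 → FSeries) =
      fun i => subst Φ ((![X 0, normalizer u 0, normalizer u 1] : Fin 3 → FSeries) i) := by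
    funext i
    fin_cases i
    · exact (hΦ.2.symm.trans (subst_X hs 0).symm)
    · rfl
    · rfl
  refine ⟨⟨fun i => ?_, ?_⟩, rfl⟩
  · rw [e]
    refine (constantCoeff_subst_of_constantCoeff_zero hΦ.1.1 _).trans ?_
    have h := fun j => VanishesBelow.one_iff.1 (normalizer_vanishesBelow u j)
    fin_cases i <;> simp [h]
  · rw [e, jacobianAtZero_subst hΦ.1.1, jacobianAtZero_normalizer, one_mul]
    exact hΦ.1.2

/-- Exchanging `y₁` and `y₂` changes the sign of the eigenvalue parameter of a normal form. -/
theorem IsFiberedDiffeo.swap {φ₁ φ₂ : FSeries} (h : IsFiberedDiffeo ![X 0, φ₁, φ₂]) :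
    IsFiberedDiffeo ![X 0, φ₂, φ₁] := by
  have e : jacobianAtZero ![X 0, φ₂, φ₁] =
      (jacobianAtZero ![X 0, φ₁, φ₂]).submatrix (Equiv.swap 1 2) (Equiv.refl _) := by
    ext i j
    fin_cases i <;> rfl
  refine ⟨⟨fun i => ?_, ?_⟩, rfl⟩
  · fin_cases i
    · exact h.1.1 0
    · exact h.1.1 2
    · exact h.1.1 1
  · rw [e, Matrix.isUnit_submatrix_equiv]
    exact h.1.2

/-- Composing the normalizing map with `Φ` transports its equations from the prepared field to `Y`.
-/
theorem lieDeriv_subst_normalizer {Φ : Fin 3 → FSeries} (hΦ : IsFiberedDiffeo Φ)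
    {Y : FVectorField} {l : ℂ} {F : Fin 2 → FSeries}
    (h : PushesForwardTo Φ Y (preparedField l F)) {u : Unknowns} (hu : ∀ j, defect l F u j = 0)
    (j : Fin 2) :
    lieDeriv Y (subst Φ (normalizer u j)) =
      ((eigenSign j : ℂ) * l) • subst Φ (normalizer u j) +
        resonantCoeff F j • (X 0 * subst Φ (normalizer u j)) +
        PowerSeries.subst (subst Φ (normalizer u 0) * subst Φ (normalizer u 1))
          (normalSeries u j) * subst Φ (normalizer u j) := by
  have hs := hasSubst_of_constantCoeff_zero hΦ.1.1
  have e : lieDeriv (preparedField l F) (normalizer u j) =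
      ((eigenSign j : ℂ) * l) • normalizer u j + resonantCoeff F j • (X 0 * normalizer u j) +
        PowerSeries.subst (normalizer u 0 * normalizer u 1) (normalSeries u j) *
          normalizer u j := by
    have := hu j
    rw [defect] at this
    linear_combination this
  have hV : PowerSeries.HasSubst (normalizer u 0 * normalizer u 1) :=
    PowerSeries.HasSubst.of_constantCoeff_zero
      (VanishesBelow.one_iff.1 ((normalizer_mul_vanishesBelow u).mono (by omega)))
  have hc : subst Φ (PowerSeries.subst (normalizer u 0 * normalizer u 1) (normalSeries u j)) =
      PowerSeries.subst (subst Φ (normalizer u 0) * subst Φ (normalizer u 1))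
        (normalSeries u j) := by
    simp only [PowerSeries.subst]
    rw [subst_comp_subst_apply hV.const hs, subst_mul hs]
  rw [lieDeriv_subst hΦ.1.1 h, e, subst_add hs, subst_add hs, subst_smul hs, subst_smul hs,
    subst_mul hs, subst_mul hs, hc, subst_X hs, hΦ.2]

end Conjugacy

theorem theorem1 (Y : FVectorField) (l r : ℂ)
    (hY : IsDoublyResonantSaddleNode l Y)
    (hr : HasResidue Y r)
    (hnd : ∀ q : ℚ, q ≤ 0 → r ≠ (q : ℂ)) :
    ∃ Φ : Fin 3 → FSeries, IsFiberedDiffeo Φ ∧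
      ∃ (a₁ a₂ : ℂ) (c₁ c₂ : PowerSeries ℂ),
        PowerSeries.constantCoeff c₁ = 0 ∧ PowerSeries.constantCoeff c₂ = 0 ∧
        PushesForwardTo Φ Y (normalForm l a₁ a₂ c₁ c₂) ∧
        a₁ + a₂ = r := by
  obtain ⟨hsing, Φ₀, Z₀, hΦ₀, hpush₀, hZ₀⟩ := hY
  obtain ⟨l', Φ, Z, hΦ, hpush, hZ, rfl⟩ := hr
  have hl' := eigenvalue_eq_or_eq_neg hsing hΦ₀ hpush₀ hZ₀ hΦ hpush hZ
  obtain ⟨F, hF, rfl⟩ := hZ.exists_eq_preparedField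
  rw [preparedResidue_preparedField] at hnd ⊢
  obtain ⟨u, hu⟩ := exists_normalizer hZ.1 hF hnd
  have hx : Y 0 = MvPowerSeries.X 0 ^ 2 := by
    have h := hpush 0
    rw [hΦ.2, lieDeriv_X] at h
    have hs := MvPowerSeries.hasSubst_of_constantCoeff_zero hΦ.1.1
    rw [h, preparedField, Fin.cons_zero, MvPowerSeries.subst_pow hs, MvPowerSeries.subst_X hs,
      hΦ.2]
  have hdiff := isFiberedDiffeo_subst_normalizer hΦ u
  have h₁ := hdiff.1.1 1
  have h₂ := hdiff.1.1 2
  have e₁ := lieDeriv_subst_normalizer hΦ hpush hu 0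
  have e₂ := lieDeriv_subst_normalizer hΦ hpush hu 1
  simp only [eigenSign, Matrix.cons_val_zero, Matrix.cons_val_one, Int.cast_neg, Int.cast_one,
    neg_mul, one_mul] at e₁ e₂
  have hc : ∀ j, PowerSeries.constantCoeff (normalSeries u j) = 0 := fun j => by
    rw [← PowerSeries.coeff_zero_eq_constantCoeff_apply, coeff_normalSeries_zero]
  -- The field that gives the residue may have parameter `-l`; then the two components, with their
  -- `a_j` and `c_j`, are exchanged, which preserves `a₁ + a₂`.
  rcases hl' with rfl | rfl
  · exact ⟨_, hdiff, resonantCoeff F 0, resonantCoeff F 1, _, _, hc 0, hc 1,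
      pushesForwardTo_normalForm h₁ h₂ hx e₁ e₂, rfl⟩
  · rw [neg_neg] at e₁
    rw [mul_comm (MvPowerSeries.subst Φ (normalizer u 0)) (MvPowerSeries.subst Φ (normalizer u 1))]
      at e₁ e₂
    exact ⟨_, hdiff.swap, resonantCoeff F 1, resonantCoeff F 0, _, _, hc 1, hc 0,
      pushesForwardTo_normalForm h₂ h₁ hx e₂ e₁, add_comm _ _⟩
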